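/- Let $X$ be a Hausdorff, second countable space with an $n$-dimensional orbifold structure $\{(V_i,G_i,\pi_i)\}_{i\in I}$: each $V_i\subseteq\mathbb R^n$ is open, $G_i$ is a finite group acting smoothly and effectively on $V_i$, and $\pi_i:V_i\to X$ is a $G_i$-invariant continuous map inducing a homeomorphism of $V_i/G_i$ onto an open set $U_i\subseteq X$; the $U_i$ cover $X$; every point of $U_i\cap U_j$ lies in some $U_k\subseteq U_i\cap U_j$; and whenever $U_i\subseteq U_j$ there is an injection $(V_i,G_i,\pi_i)\to(V_j,G_j,\pi_j)$, that is, a smooth open embedding $\varphi:V_i\to V_j$ with $\pi_j\circ\varphi=\pi_i$, equivariant along an injective homomorphism $G_i\to G_j$. Suppose that the covering $\{U_i\}$ is closed under non-empty finite intersections. Let $\bigwedge^kT^*X$ be the orbifold bundle obtained from $\coprod_iV_i\times\bigwedge^k(\mathbb R^n)^*$ by gluing along all injections and along the actions of the $G_i$ (acting on covectors by pull-back). A $k$-form on $X$ is a continuous section $s:X\to\bigwedge^kT^*X$ that has on every $V_i$ a smooth lift $\tilde s|_{V_i}\in\Omega^k(V_i)$, i.e. $s(\pi_i(x))=[x,\tilde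 s(x)]$ for $x\in V_i$. These lifts are unique; the vector space structure and the differential $d$ of $\Omega^*(X)$ are those of the lifts. Let $N=\coprod_iV_i$, let $\Gamma$ be the pseudogroup of local homeomorphisms of $N$ generated by all injections $V_i\to V_j$ and by the actions of the elements of each $G_i$ on $V_i$, and let $\Omega^k_\Gamma(N)\subseteq\Omega^k(N)$ consist of the forms $\xi$ with $\xi|_U=\gamma^*(\xi|_{\gamma(U)})$ for every $\gamma\in\Gamma$ with domain $U$. Then $\Omega^*(X)$ and $\Omega^*(N)$ are cochain complexes, $\Omega^*_\Gamma(N)$ is a subcomplex of $\Omega^*(N)$, and the map $$\Omega^k(X)\ni s\longmapsto\sum_i\tilde s|_{V_i}\in\Omega^k(N),\qquad k\ge0,$$ sending a form on $X$ to its (unique) family of local lifts, is well defined, linear and injective, commutes with $d$, and has image $\Omega^k_\Gamma(N)$; that is, it is a chain isomorphism of $\Omega^*(X)$ onto $\Omega^*_\Gamma(N)$. -/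

import Mathlib

open scoped ContDiff Topology
open TopologicalSpace

namespace OrbifoldForms

universe u v w

/-- The model space `ℝⁿ`. -/
abbrev Euc (n : ℕ) : Type := EuclideanSpace ℝ (Fin n)

/-- `Λᵏ(ℝⁿ)*`: the alternating `k`-forms on `ℝⁿ`. -/
abbrev Cov (n k : ℕ) : Type := Euc n [⋀^Fin k]→L[ℝ] ℝ

/-! ### Smooth maps on open subsets of `ℝⁿ` -/

section OpenSubsets

variable {n : ℕ} {V : Opens (Euc n)} {F : Type*} [NormedAddCommGroup F]

/-- Extension by zero of a function on an open set `V` to all of `ℝⁿ`. Near the points of `V` it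
is the function itself, so that smoothness and derivatives on `V` can be read off from it. -/
noncomputable def ext0 (f : V → F) : Euc n → F := Function.extend Subtype.val f 0

@[simp] theorem ext0_coe (f : V → F) (x : V) : ext0 f (x : Euc n) = f x :=
  Subtype.val_injective.extend_apply f 0 x

theorem ext0_mem (f : V → F) {x : Euc n} (hx : x ∈ V) : ext0 f x = f ⟨x, hx⟩ :=
  ext0_coe f ⟨x, hx⟩

theorem mem_nhds_coe (x : V) : (V : Set (Euc n)) ∈ 𝓝 (x : Euc n) := V.isOpen.mem_nhds x.2

variable [NormedSpace ℝ F]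

/-- Smoothness of a function on the open set `V`. -/
def Smooth (f : V → F) : Prop := ContDiffOn ℝ ∞ (ext0 f) V

/-- The derivative at `x` of a function on the open set `V`. -/
noncomputable def D (f : V → F) (x : V) : Euc n →L[ℝ] F := fderiv ℝ (ext0 f) x

theorem Smooth.contDiffAt {f : V → F} (hf : Smooth f) (x : V) : ContDiffAt ℝ ∞ (ext0 f) x :=
  ContDiffOn.contDiffAt hf (mem_nhds_coe x)

theorem Smooth.continuous {f : V → F} (hf : Smooth f) : Continuous f := by
  have h := (ContDiffOn.continuousOn hf).domRestrict
  have e : Set.domRestrict (V : Set (Euc n)) (ext0 f) = f := by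
    funext x
    exact ext0_coe f x
  exact e ▸ h

end OpenSubsets

/-! ### Local uniformizing systems and their injections -/

/-- An `n`-dimensional local uniformizing system `(V, G, π)` in `X`: an open set `V ⊆ ℝⁿ`, a finite
group `G` acting smoothly and effectively on `V`, and a `G`-invariant continuous map `π : V → X`
inducing a homeomorphism of `V / G` onto an open subset `U = π(V)` of `X`. The last condition says
that `π` is an open map whose non-empty fibres are the orbits of `G`. -/
structure UniformizingSystem (n : ℕ) (X : Type u) [TopologicalSpace X] where
  V : Opens (Euc n)
  G : Type w
  [group : Group G]
  [finite : Finite G]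
  [action : MulAction G V]
  [effective : FaithfulSMul G V]
  smooth_smul : ∀ g : G, Smooth fun x : V ↦ ((g • x : V) : Euc n)
  π : V → X
  continuous_π : Continuous π
  isOpenMap_π : IsOpenMap π
  π_eq_iff : ∀ x y : V, π x = π y ↔ ∃ g : G, g • x = y

attribute [instance] UniformizingSystem.group UniformizingSystem.finite
  UniformizingSystem.action UniformizingSystem.effective

variable {n : ℕ} {X : Type u} [TopologicalSpace X] {ι : Type v}

/-- The open subset of `X` uniformized by `(V, G, π)`. -/
def UniformizingSystem.U (A : UniformizingSystem.{u, w} n X) : Set X := Set.range A.π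

/-- An injection `(V, G, π) → (V', G', π')`: a smooth open embedding `V → V'` over `X`, equivariant
along an injective homomorphism `G → G'`. -/
structure Injection (A B : UniformizingSystem.{u, w} n X) where
  toFun : A.V → B.V
  hom : A.G →* B.G
  hom_injective : Function.Injective hom
  isOpenEmbedding : Topology.IsOpenEmbedding toFun
  smooth : Smooth fun x : A.V ↦ (toFun x : Euc n)
  immersive : ∀ x : A.V, Function.Injective (D (fun y : A.V ↦ (toFun y : Euc n)) x)
  map_smul : ∀ (g : A.G) (x : A.V), toFun (g • x) = hom g • toFun x
  π_map : ∀ x : A.V, B.π (toFun x) = A.π x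

/-- An orbifold structure on `X`: a family of local uniformizing systems covering `X`, such that
`U i ⊆ U j` entails an injection of the `i`-th system into the `j`-th, and such that every point of
`U i ∩ U j` has a neighbourhood `U k ⊆ U i ∩ U j`. -/
structure OrbifoldAtlas (n : ℕ) (X : Type u) [TopologicalSpace X] (ι : Type v) where
  chart : ι → UniformizingSystem.{u, w} n X
  cover : ∀ x : X, ∃ i, x ∈ (chart i).U
  embed : ∀ i j, (chart i).U ⊆ (chart j).U → Nonempty (Injection (chart i) (chart j))
  refine : ∀ i j, ∀ x ∈ (chart i).U ∩ (chart j).U,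
    ∃ k, x ∈ (chart k).U ∧ (chart k).U ⊆ (chart i).U ∩ (chart j).U

namespace OrbifoldAtlas

variable (O : OrbifoldAtlas.{u, v, w} n X ι)

/-- The covering `{U i}` is closed under (non-empty) intersections. -/
def ClosedUnderIntersections : Prop :=
  ∀ i j, ((O.chart i).U ∩ (O.chart j).U).Nonempty →
    ∃ k, (O.chart k).U = (O.chart i).U ∩ (O.chart j).U

/-! ### The manifold `N = ∐ V i` and its forms -/

/-- The manifold `N = ∐ᵢ Vᵢ`. -/
abbrev N : Type v := Σ i, (O.chart i).V

/-- The map `N → X` given by the `π i`. -/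
def toX (p : O.N) : X := (O.chart p.1).π p.2

/-- Smooth `k`-forms on `N`. The tangent space of `N` at each point is `ℝⁿ`. -/
def Form (k : ℕ) : Submodule ℝ (O.N → Cov n k) where
  carrier := {α | ∀ i, Smooth fun x : (O.chart i).V ↦ α ⟨i, x⟩}
  add_mem' {a b} ha hb i := by
    refine (ContDiffOn.add (ha i) (hb i)).congr fun x hx ↦ ?_
    simp [ext0_mem _ hx]
  zero_mem' i := by
    refine (contDiffOn_const (c := 0)).congr fun x hx ↦ ?_
    simp [ext0_mem _ hx]
  smul_mem' c a ha i := by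
    refine (ContDiffOn.const_smul c (ha i)).congr fun x hx ↦ ?_
    simp [ext0_mem _ hx]

variable {O}

/-- The restriction of a form on `N` to `V i`, extended by zero to `ℝⁿ`. -/
noncomputable def res {k : ℕ} (α : O.N → Cov n k) (i : ι) : Euc n → Cov n k :=
  ext0 fun x : (O.chart i).V ↦ α ⟨i, x⟩

theorem res_mem {k : ℕ} (α : O.N → Cov n k) (i : ι) {x : Euc n} (hx : x ∈ (O.chart i).V) :
    res α i x = α ⟨i, ⟨x, hx⟩⟩ := ext0_mem _ hx

theorem res_coe {k : ℕ} (α : O.N → Cov n k) (i : ι) (x : (O.chart i).V) :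
    res α i x = α ⟨i, x⟩ := ext0_coe _ x

theorem contDiffAt_res {k : ℕ} (α : O.Form k) (i : ι) (x : (O.chart i).V) :
    ContDiffAt ℝ ∞ (res α.1 i) x := Smooth.contDiffAt (α.2 i) x

theorem differentiableAt_res {k : ℕ} (α : O.Form k) (i : ι) (x : (O.chart i).V) :
    DifferentiableAt ℝ (res α.1 i) x := (contDiffAt_res α i x).differentiableAt (by simp)

variable (O)

/-- The exterior derivative on `N`. -/
noncomputable def dN (k : ℕ) : O.Form k →ₗ[ℝ] O.Form (k + 1) where
  toFun α := ⟨fun p ↦ extDeriv (res α.1 p.1) (p.2 : Euc n), fun i ↦ by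
    have h : ContDiffOn ℝ ∞ (fderiv ℝ (res α.1 i)) (O.chart i).V :=
      ContDiffOn.fderiv_of_isOpen (m := ∞) (n := ∞) (α.2 i) (O.chart i).V.isOpen (by simp)
    refine ((ContinuousAlternatingMap.alternatizeUncurryFinCLM ℝ (Euc n) ℝ).contDiff.comp_contDiffOn
      h).congr fun x hx ↦ ?_
    rw [ext0_mem _ hx]
    rfl⟩
  map_add' a b := by
    ext1
    funext p
    change extDeriv (res (a.1 + b.1) p.1) (p.2 : Euc n) = _
    have e : res (a.1 + b.1) p.1 =ᶠ[𝓝 (p.2 : Euc n)] res a.1 p.1 + res b.1 p.1 := by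
      filter_upwards [mem_nhds_coe p.2] with x hx
      simp [res_mem _ _ (show x ∈ (O.chart p.1).V from hx)]
    rw [e.extDeriv_eq, extDeriv_add (differentiableAt_res a _ _) (differentiableAt_res b _ _)]
    rfl
  map_smul' c a := by
    ext1
    funext p
    change extDeriv (res (c • a.1) p.1) (p.2 : Euc n) = _
    have e : res (c • a.1) p.1 =ᶠ[𝓝 (p.2 : Euc n)] c • res a.1 p.1 := by
      filter_upwards [mem_nhds_coe p.2] with x hx
      simp [res_mem _ _ (show x ∈ (O.chart p.1).V from hx)]
    rw [e.extDeriv_eq, extDeriv_smul]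
    rfl

/-! ### The pseudogroup `Γ` and the invariant forms -/

/-- The derivative at `p` of a map `f : N → N`. -/
noncomputable def tangentMap (f : O.N → O.N) (p : O.N) : Euc n →L[ℝ] Euc n :=
  D (fun x : (O.chart p.1).V ↦ ((f ⟨p.1, x⟩).2 : Euc n)) p.2

/-- The maps generating the pseudogroup: the injections `V i → V j` and the actions of the elements
of the groups `G i` on `V i`. -/
inductive Elementary : ∀ {i j : ι}, ((O.chart i).V → (O.chart j).V) → Prop
  | inj {i j : ι} (φ : Injection (O.chart i) (O.chart j)) : Elementary φ.toFun
  | act {i : ι} (g : (O.chart i).G) : Elementary fun x : (O.chart i).V ↦ g • x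

/-- The generators of `Γ`: the injections and the group elements, each as a local homeomorphism of
`N` with domain `V i`. -/
def generators : Set (OpenPartialHomeomorph O.N O.N) :=
  {γ | ∃ i j, ∃ f : (O.chart i).V → (O.chart j).V, O.Elementary f ∧
    γ.source = Set.range (Sigma.mk i) ∧ ∀ x, γ ⟨i, x⟩ = ⟨j, f x⟩}

/-- The pseudogroup `Γ` on `N` generated by the injections and the group actions: the smallest one
containing them. A pseudogroup is a `StructureGroupoid` that is closed under restriction to open
sets. -/
def Γ : StructureGroupoid O.N :=
  sInf {P | ClosedUnderRestriction P ∧ ∀ γ ∈ O.generators, γ ∈ P}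

/-- `k`-forms on `N` with `α = γ^* α` on the domain of every `γ ∈ Γ`. -/
def InvariantForm (k : ℕ) : Submodule ℝ (O.Form k) where
  carrier := {α | ∀ γ ∈ O.Γ, ∀ p ∈ γ.source,
    α.1 p = (α.1 (γ p)).compContinuousLinearMap (O.tangentMap γ p)}
  add_mem' {a b} ha hb γ hγ p hp := by
    ext m
    have h1 := DFunLike.congr_fun (ha γ hγ p hp) m
    have h2 := DFunLike.congr_fun (hb γ hγ p hp) m
    simp only [ContinuousAlternatingMap.compContinuousLinearMap_apply] at h1 h2
    simp [h1, h2]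
  zero_mem' γ hγ p hp := by
    ext m
    simp
  smul_mem' c a ha γ hγ p hp := by
    ext m
    have h1 := DFunLike.congr_fun (ha γ hγ p hp) m
    simp only [ContinuousAlternatingMap.compContinuousLinearMap_apply] at h1
    simp [h1]

/-! ### The orbifold bundle `Λᵏ T^*X` and its sections -/

/-- The gluing of the trivial bundles `V i × Λᵏ(ℝⁿ)*` along the injections and along the actions of
the groups `G i`; all of them act on covectors by pull-back. -/
inductive Glue (k : ℕ) : O.N × Cov n k → O.N × Cov n k → Prop
  | mk {i j : ι} (f : (O.chart i).V → (O.chart j).V) (hf : O.Elementary f) (x : (O.chart i).V)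
      (b : Cov n k) :
      Glue k (⟨i, x⟩, b.compContinuousLinearMap (D (fun y ↦ (f y : Euc n)) x)) (⟨j, f x⟩, b)

/-- The total space of the orbifold bundle `Λᵏ T^*X`, with the quotient topology: the quotient of
`∐ V i × Λᵏ(ℝⁿ)*` by the equivalence relation generated by the gluing. -/
abbrev Bundle (k : ℕ) : Type v := Quot (O.Glue k)

/-- The projection `Λᵏ T^*X → X`. -/
def Bundle.proj {k : ℕ} : O.Bundle k → X :=
  Quot.lift (fun P ↦ O.toX P.1) (by
    rintro _ _ ⟨f, φ | g, x, b⟩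
    · exact (φ.π_map x).symm
    · exact ((O.chart _).π_eq_iff _ _).2 ⟨g, rfl⟩)

variable {O} in
/-- `η` is a lift to `V i` of the map `s : X → Λᵏ T^*X`. -/
def IsLocalLift {k : ℕ} (s : X → O.Bundle k) (i : ι) (η : (O.chart i).V → Cov n k) : Prop :=
  ∀ x, s ((O.chart i).π x) = Quot.mk _ (⟨i, x⟩, η x)

/-- A `k`-form on the orbifold `X`: a continuous section of `Λᵏ T^*X` with smooth lifts to all
`V i`. -/
@[ext] structure OrbForm (k : ℕ) where
  toFun : X → O.Bundle k
  continuous_toFun : Continuous toFun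
  proj_toFun : ∀ x, Bundle.proj O (toFun x) = x
  exists_lift : ∀ i, ∃ η : (O.chart i).V → Cov n k, Smooth η ∧ IsLocalLift toFun i η

variable {O}

/-- The form `∑ᵢ s̃|Vᵢ` on `N` consists of lifts of `s`. -/
def IsLift {k : ℕ} (s : O.OrbForm k) (α : O.Form k) : Prop :=
  ∀ i, IsLocalLift s.toFun i fun x ↦ α.1 ⟨i, x⟩

theorem IsLift.apply {k : ℕ} {s : O.OrbForm k} {α : O.Form k} (h : IsLift s α) (p : O.N) :
    s.toFun (O.toX p) = Quot.mk _ (p, α.1 p) := h p.1 p.2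

/-! ### Uniqueness of lifts -/

variable (O) in
theorem Elementary.π_map {i j : ι} {f : (O.chart i).V → (O.chart j).V} (hf : O.Elementary f)
    (x : (O.chart i).V) : (O.chart i).π x = (O.chart j).π (f x) := by
  rcases hf with φ | g
  · exact (φ.π_map x).symm
  · exact ((O.chart _).π_eq_iff _ _).2 ⟨g, rfl⟩

theorem Elementary.smooth {i j : ι} {f : (O.chart i).V → (O.chart j).V} (hf : O.Elementary f) :
    Smooth fun x ↦ (f x : Euc n) := by
  rcases hf with φ | g
  · exact φ.smooth
  · exact (O.chart i).smooth_smul g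

theorem Elementary.continuous {i j : ι} {f : (O.chart i).V → (O.chart j).V} (hf : O.Elementary f) :
    Continuous f := continuous_induced_rng.2 hf.smooth.continuous

theorem Elementary.injective_D {i j : ι} {f : (O.chart i).V → (O.chart j).V}
    (hf : O.Elementary f) (x : (O.chart i).V) :
    Function.Injective (D (fun y ↦ (f y : Euc n)) x) := by
  rcases hf with φ | g
  · exact φ.immersive x
  · have h1 := (Smooth.contDiffAt ((O.chart i).smooth_smul g) x).differentiableAt (by simp)
    have h2 := (Smooth.contDiffAt ((O.chart i).smooth_smul g⁻¹) (g • x)).differentiableAt (by simp)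
    have e : (ext0 (fun y : (O.chart i).V ↦ ((g⁻¹ • y : (O.chart i).V) : Euc n))) ∘
        (ext0 (fun y : (O.chart i).V ↦ ((g • y : (O.chart i).V) : Euc n))) =ᶠ[𝓝 (x : Euc n)] id := by
      filter_upwards [mem_nhds_coe x] with y hy
      have := ext0_mem (fun y : (O.chart i).V ↦ ((g • y : (O.chart i).V) : Euc n)) hy
      simp [this]
    have h2' := h2.hasFDerivAt
    rw [← ext0_coe (fun y : (O.chart i).V ↦ ((g • y : (O.chart i).V) : Euc n)) x] at h2'
    have h3 := (h2'.comp (x : Euc n) h1.hasFDerivAt).congr_of_eventuallyEq e.symm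
    have h4 := h3.unique (hasFDerivAt_id _)
    intro a b hab
    have ha := DFunLike.congr_fun h4 a
    have hb := DFunLike.congr_fun h4 b
    change _ = a at ha
    change _ = b at hb
    rw [← ha, ← hb]
    exact congrArg (fderiv ℝ (ext0 fun y : (O.chart i).V ↦ ((g⁻¹ • y : (O.chart i).V) : Euc n)) _) hab

/-- The covectors `P` and `Q` correspond under the germ of a local diffeomorphism over `X`. -/
def Related {k : ℕ} (P Q : O.N × Cov n k) : Prop :=
  ∃ (f : Euc n → Euc n) (f' : Euc n ≃L[ℝ] Euc n),
    HasStrictFDerivAt f (f' : Euc n →L[ℝ] Euc n) (P.1.2 : Euc n) ∧ f P.1.2 = Q.1.2 ∧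
    (∀ᶠ w in 𝓝 (P.1.2 : Euc n), ∀ (h : w ∈ (O.chart P.1.1).V) (h' : f w ∈ (O.chart Q.1.1).V),
      (O.chart P.1.1).π ⟨w, h⟩ = (O.chart Q.1.1).π ⟨f w, h'⟩) ∧
    P.2 = Q.2.compContinuousLinearMap (f' : Euc n →L[ℝ] Euc n)

theorem Related.refl {k : ℕ} (P : O.N × Cov n k) : Related P P :=
  ⟨id, .refl ℝ _, hasStrictFDerivAt_id _, rfl, .of_forall fun _ _ _ ↦ rfl, by ext; simp⟩

theorem Related.symm {k : ℕ} {P Q : O.N × Cov n k} (h : Related P Q) : Related Q P := by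
  obtain ⟨f, f', hf, hfp, hπ, hPQ⟩ := h
  refine ⟨hf.localInverse f f' _, f'.symm, hfp ▸ hf.to_localInverse, ?_, ?_, ?_⟩
  · rw [← hfp]
    exact hf.localInverse_apply_image
  · have h1 := hf.localInverse_tendsto.eventually hπ
    have h2 := hf.eventually_right_inverse
    rw [hfp] at h1 h2
    filter_upwards [h1, h2] with y hy hy' h h'
    have e : f (hf.localInverse f f' _ y) ∈ (O.chart Q.1.1).V := hy'.symm ▸ h
    rw [hy h' e]
    congr 1
    exact Subtype.ext hy'.symm
  · rw [hPQ]
    ext m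
    simp only [ContinuousAlternatingMap.compContinuousLinearMap_apply]
    congr 1
    funext t
    simp

theorem Related.trans {k : ℕ} {P Q R : O.N × Cov n k} (h : Related P Q) (h' : Related Q R) :
    Related P R := by
  obtain ⟨f, f', hf, hfp, hπ, hPQ⟩ := h
  obtain ⟨g, g', hg, hgp, hπ', hQR⟩ := h'
  rw [← hfp] at hg hπ'
  refine ⟨g ∘ f, f'.trans g', hg.comp _ hf, by simp [hfp, hgp], ?_, ?_⟩
  · have hc := hf.continuousAt
    have h3 : ∀ᶠ w in 𝓝 (P.1.2 : Euc n), f w ∈ (O.chart Q.1.1).V :=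
      hc.eventually_mem (hfp ▸ mem_nhds_coe Q.1.2)
    filter_upwards [hπ, hc.eventually hπ', h3] with w h1 h2 h3 h h'
    rw [h1 h h3, h2 h3 h']
    rfl
  · rw [hPQ, hQR]
    rfl

theorem Glue.related {k : ℕ} {P Q : O.N × Cov n k} (h : O.Glue k P Q) : Related P Q := by
  obtain ⟨f, hf, x, b⟩ := h
  have hc := hf.smooth.contDiffAt x
  let e := (LinearEquiv.ofInjectiveEndo
    (D (fun y ↦ (f y : Euc n)) x : Euc n →ₗ[ℝ] Euc n) (hf.injective_D x)).toContinuousLinearEquiv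
  have he : (e : Euc n →L[ℝ] Euc n) = D (fun y ↦ (f y : Euc n)) x := by
    ext1 v
    rfl
  refine ⟨ext0 fun y ↦ (f y : Euc n), e, ?_, ext0_coe _ _, ?_, ?_⟩
  · rw [he]
    exact hc.hasStrictFDerivAt (by simp)
  · refine .of_forall fun w h h' ↦ ?_
    rw [Elementary.π_map O hf]
    congr 1
    exact Subtype.ext (ext0_mem (fun y ↦ (f y : Euc n)) h).symm
  · rw [he]

theorem related_of_mk_eq {k : ℕ} {P Q : O.N × Cov n k}
    (h : (Quot.mk _ P : O.Bundle k) = Quot.mk _ Q) : Related P Q := by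
  have h' := Quot.eqvGen_exact h
  clear h
  induction h' with
  | rel _ _ h => exact h.related
  | refl _ => exact .refl _
  | symm _ _ _ ih => exact ih.symm
  | trans _ _ _ _ _ ih ih' => exact ih.trans ih'

/-- The points near which `π` is injective. -/
def Regular {A : UniformizingSystem.{u, w} n X} (x : A.V) : Prop :=
  ∀ᶠ z in 𝓝 (x, x), A.π z.1 = A.π z.2 → z.1 = z.2

theorem dense_regular (A : UniformizingSystem.{u, w} n X) : Dense {x : A.V | Regular x} := by
  have hc : ∀ g : A.G, Continuous fun x : A.V ↦ g • x := fun g ↦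
    continuous_induced_rng.2 (A.smooth_smul g).continuous
  have hF : ∀ g : A.G, IsClosed {x : A.V | g • x = x} := fun g ↦ isClosed_eq (hc g) continuous_id
  have : BaireSpace A.V := A.V.isOpen.baireSpace
  refine (dense_iInter_of_isOpen (f := fun g : A.G ↦ (frontier {x : A.V | g • x = x})ᶜ)
    (fun g ↦ isClosed_frontier.isOpen_compl) (fun g ↦ ?_)).mono fun x hx ↦ ?_
  · rw [← interior_eq_empty_iff_dense_compl]
    exact interior_frontier (hF g)
  · have key : ∀ g : A.G, ∀ᶠ z : A.V × A.V in 𝓝 (x, x), g • z.1 = z.2 → z.1 = z.2 := by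
      intro g
      by_cases hg : g • x = x
      · have hi : x ∈ interior {x : A.V | g • x = x} := by
          by_contra hi
          refine Set.mem_iInter.1 hx g ?_
          rw [(hF g).frontier_eq]
          exact ⟨hg, hi⟩
        have h1 : ∀ᶠ z : A.V × A.V in 𝓝 (x, x), g • z.1 = z.1 :=
          (continuous_fst.tendsto (x, x)).eventually (mem_interior_iff_mem_nhds.1 hi)
        filter_upwards [h1] with z h h'
        rw [← h', h]
      · have h1 : IsOpen {z : A.V × A.V | g • z.1 ≠ z.2} :=
          isOpen_ne_fun ((hc g).comp continuous_fst) continuous_snd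
        filter_upwards [h1.mem_nhds (show (x, x) ∈ _ from hg)] with z h h'
        exact absurd h' h
    filter_upwards [Filter.eventually_all.2 key] with z hz h
    obtain ⟨g, hg⟩ := (A.π_eq_iff _ _).1 h
    exact hz g hg

theorem Related.eq_of_regular {k : ℕ} {p : O.N} (hp : Regular p.2) {a b : Cov n k}
    (h : Related (p, a) (p, b)) : a = b := by
  obtain ⟨f, f', hf, hfp, hπ, hab⟩ := h
  dsimp only at hf hfp hπ hab
  have hp' : ∀ᶠ z : Euc n × Euc n in 𝓝 ((p.2 : Euc n), (p.2 : Euc n)),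
      ∀ (h1 : z.1 ∈ (O.chart p.1).V) (h2 : z.2 ∈ (O.chart p.1).V),
        (O.chart p.1).π ⟨z.1, h1⟩ = (O.chart p.1).π ⟨z.2, h2⟩ → z.1 = z.2 := by
    have ho := (O.chart p.1).V.isOpenEmbedding'
    have ho2 := (ho.prodMap ho).map_nhds_eq (p.2, p.2)
    change _ = 𝓝 ((p.2 : Euc n), (p.2 : Euc n)) at ho2
    rw [← ho2, Filter.eventually_map]
    filter_upwards [hp] with z hz h1 h2 h
    exact congrArg Subtype.val (hz h)
  have hc : Filter.Tendsto (fun w ↦ (w, f w)) (𝓝 (p.2 : Euc n))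
      (𝓝 ((p.2 : Euc n), (p.2 : Euc n))) := by
    have := continuousAt_id.prodMk hf.continuousAt
    rw [ContinuousAt] at this
    simpa [hfp] using this
  have h3 : ∀ᶠ w in 𝓝 (p.2 : Euc n), f w ∈ (O.chart p.1).V :=
    hf.continuousAt.eventually_mem (hfp.symm ▸ mem_nhds_coe p.2)
  have e : f =ᶠ[𝓝 (p.2 : Euc n)] id := by
    filter_upwards [hc.eventually hp', hπ, h3, mem_nhds_coe p.2] with w h1 h2 h3 h4
    exact (h1 h4 h3 (h2 h4 h3)).symm
  have h4 := (hf.hasFDerivAt.congr_of_eventuallyEq e.symm).unique (hasFDerivAt_id _)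
  rw [hab, h4]
  ext m
  rfl

theorem continuous_form {k : ℕ} (α : O.Form k) : Continuous α.1 :=
  continuous_sigma fun i ↦ Smooth.continuous (α.2 i)

theorem continuous_form_mk {k : ℕ} (α : O.Form k) (i : ι) :
    Continuous fun x : (O.chart i).V ↦ α.1 ⟨i, x⟩ := Smooth.continuous (α.2 i)

theorem IsLift.unique {k : ℕ} {s : O.OrbForm k} {α β : O.Form k} (hα : IsLift s α)
    (hβ : IsLift s β) : α = β := by
  ext1
  funext ⟨i, x⟩
  refine congrFun ((continuous_form_mk α i).ext_on (dense_regular (O.chart i))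
    (continuous_form_mk β i) fun y hy ↦ ?_) x
  exact (related_of_mk_eq ((hα i y).symm.trans (hβ i y))).eq_of_regular (p := ⟨i, y⟩) hy

theorem exists_isLift {k : ℕ} (s : O.OrbForm k) : ∃ α, IsLift s α := by
  choose η hη hs using s.exists_lift
  exact ⟨⟨fun p ↦ η p.1 p.2, hη⟩, hs⟩

/-- The form `∑ᵢ s̃|Vᵢ` on `N` given by the lifts of `s`. -/
noncomputable def lift {k : ℕ} (s : O.OrbForm k) : O.Form k := (exists_isLift s).choose

theorem isLift_lift {k : ℕ} (s : O.OrbForm k) : IsLift s (lift s) := (exists_isLift s).choose_spec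

/-! ### The forms on `N` that are lifts of forms on `X` -/

/-- Compatibility of a form on `N` with the gluing of the cotangent bundles. -/
def IsCompat {k : ℕ} (α : O.Form k) : Prop :=
  ∀ ⦃i j⦄ (f : (O.chart i).V → (O.chart j).V), O.Elementary f → ∀ x,
    α.1 ⟨i, x⟩ = (α.1 ⟨j, f x⟩).compContinuousLinearMap (D (fun y ↦ (f y : Euc n)) x)

theorem IsCompat.zero (k : ℕ) : IsCompat (0 : O.Form k) := fun i j f hf x ↦ by
  ext m
  simp

theorem IsCompat.add {k : ℕ} {α β : O.Form k} (hα : IsCompat α) (hβ : IsCompat β) :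
    IsCompat (α + β) := fun i j f hf x ↦ by
  ext m
  have h1 := DFunLike.congr_fun (hα f hf x) m
  have h2 := DFunLike.congr_fun (hβ f hf x) m
  simp only [ContinuousAlternatingMap.compContinuousLinearMap_apply] at h1 h2
  simp [h1, h2]

theorem IsCompat.smul {k : ℕ} {α : O.Form k} (c : ℝ) (hα : IsCompat α) :
    IsCompat (c • α) := fun i j f hf x ↦ by
  ext m
  have h1 := DFunLike.congr_fun (hα f hf x) m
  simp only [ContinuousAlternatingMap.compContinuousLinearMap_apply] at h1
  simp [h1]

theorem IsCompat.neg {k : ℕ} {α : O.Form k} (hα : IsCompat α) : IsCompat (-α) := by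
  rw [← neg_one_smul ℝ α]
  exact hα.smul _

theorem IsCompat.sub {k : ℕ} {α β : O.Form k} (hα : IsCompat α) (hβ : IsCompat β) :
    IsCompat (α - β) := by
  have e : α - β = α + -β := sub_eq_add_neg α β
  exact e ▸ hα.add hβ.neg

theorem IsCompat.nsmul {k : ℕ} {α : O.Form k} (c : ℕ) (hα : IsCompat α) : IsCompat (c • α) := by
  have e : (c : ℝ) • α = c • α := Nat.cast_smul_eq_nsmul ℝ c α
  exact e ▸ hα.smul _

theorem IsCompat.zsmul {k : ℕ} {α : O.Form k} (c : ℤ) (hα : IsCompat α) : IsCompat (c • α) := by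
  have e : (c : ℝ) • α = c • α := Int.cast_smul_eq_zsmul ℝ c α
  exact e ▸ hα.smul _

theorem continuous_D {i j : ι} {f : (O.chart i).V → (O.chart j).V} (hf : O.Elementary f) :
    Continuous (D fun y ↦ (f y : Euc n)) := by
  have h : ContDiffOn ℝ ∞ (fderiv ℝ (ext0 fun y ↦ (f y : Euc n))) (O.chart i).V :=
    ContDiffOn.fderiv_of_isOpen (m := ∞) (n := ∞) hf.smooth (O.chart i).V.isOpen (by simp)
  exact h.continuousOn.domRestrict

theorem IsLift.isCompat {k : ℕ} {s : O.OrbForm k} {α : O.Form k} (hα : IsLift s α) :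
    IsCompat α := by
  intro i j f hf x
  ext m
  have h1 : Continuous fun x : (O.chart i).V ↦ α.1 ⟨i, x⟩ m :=
    (continuous_form_mk α i).eval_const m
  have h2 : Continuous fun x : (O.chart i).V ↦
      α.1 ⟨j, f x⟩ (D (fun y ↦ (f y : Euc n)) x ∘ m) := by
    refine ((continuous_form_mk α j).comp hf.continuous).eval (continuous_pi fun l ↦ ?_)
    exact (continuous_D hf).clm_apply continuous_const
  refine congrFun (h1.ext_on (dense_regular (O.chart i)) h2 fun y hy ↦ ?_) x
  refine DFunLike.congr_fun (Related.eq_of_regular (p := ⟨i, y⟩) hy (related_of_mk_eq ?_)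
    (b := (α.1 ⟨j, f y⟩).compContinuousLinearMap (D (fun y ↦ (f y : Euc n)) y))) m
  rw [Quot.sound (Glue.mk f hf y (α.1 ⟨j, f y⟩)), ← hα i y, ← hα j (f y),
    Elementary.π_map O hf]

theorem IsCompat.dN {k : ℕ} {α : O.Form k} (hα : IsCompat α) :
    IsCompat (O.dN k α) := by
  intro i j f hf x
  have hc := hf.smooth.contDiffAt x
  have e : res α.1 i =ᶠ[𝓝 (x : Euc n)] fun w ↦ (res α.1 j (ext0 (fun y ↦ (f y : Euc n)) w)
      ).compContinuousLinearMap (fderiv ℝ (ext0 fun y ↦ (f y : Euc n)) w) := by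
    filter_upwards [mem_nhds_coe x] with w hw
    rw [res_mem _ _ hw, hα f hf, ext0_mem _ hw, res_coe]
    rfl
  change extDeriv (res α.1 i) (x : Euc n) = (extDeriv (res α.1 j) (f x : Euc n)
    ).compContinuousLinearMap (fderiv ℝ (ext0 fun y ↦ (f y : Euc n)) x)
  have hd := differentiableAt_res α j (f x)
  rw [← ext0_coe (fun y ↦ (f y : Euc n)) x] at hd ⊢
  rw [e.extDeriv_eq]
  exact extDeriv_pullback hd hc (by
    rw [minSmoothness_of_isRCLikeNormedField]
    exact WithTop.coe_le_coe.2 (le_top (a := (2 : ℕ∞))))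

theorem mk_eq_of_compat {k : ℕ} {α : O.Form k} (hα : IsCompat α) {p q : O.N}
    (h : O.toX p = O.toX q) :
    (Quot.mk _ (p, α.1 p) : O.Bundle k) = Quot.mk _ (q, α.1 q) := by
  have key : ∀ {i j} (f : (O.chart i).V → (O.chart j).V), O.Elementary f → ∀ x,
      (Quot.mk _ (⟨i, x⟩, α.1 ⟨i, x⟩) : O.Bundle k) = Quot.mk _ (⟨j, f x⟩, α.1 ⟨j, f x⟩) := by
    intro i j f hf x
    rw [hα f hf x]
    exact Quot.sound (Glue.mk f hf x _)
  have key2 : ∀ {i} (x y : (O.chart i).V), (O.chart i).π x = (O.chart i).π y →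
      (Quot.mk _ (⟨i, x⟩, α.1 ⟨i, x⟩) : O.Bundle k) = Quot.mk _ (⟨i, y⟩, α.1 ⟨i, y⟩) := by
    intro i x y hxy
    obtain ⟨g, rfl⟩ := ((O.chart i).π_eq_iff _ _).1 hxy
    exact key _ (.act g) x
  obtain ⟨i, x⟩ := p
  obtain ⟨j, y⟩ := q
  change (O.chart i).π x = (O.chart j).π y at h
  obtain ⟨l, ⟨u, hu⟩, hl⟩ := O.refine i j ((O.chart i).π x) ⟨⟨x, rfl⟩, ⟨y, h.symm⟩⟩
  obtain ⟨φ⟩ := O.embed l i fun z hz ↦ (hl hz).1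
  obtain ⟨ψ⟩ := O.embed l j fun z hz ↦ (hl hz).2
  rw [key2 x (φ.toFun u) (by rw [φ.π_map, hu]), key2 y (ψ.toFun u) (by rw [ψ.π_map, hu, h]),
    ← key _ (.inj φ) u, ← key _ (.inj ψ) u]

theorem toX_surjective : Function.Surjective O.toX := fun x ↦ by
  obtain ⟨i, y, hy⟩ := O.cover x
  exact ⟨⟨i, y⟩, hy⟩

theorem continuous_toX : Continuous O.toX := continuous_sigma fun i ↦ (O.chart i).continuous_π

theorem isOpenMap_toX : IsOpenMap O.toX := isOpenMap_sigma.2 fun i ↦ (O.chart i).isOpenMap_π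

/-- The form on `X` whose lift is a given compatible form on `N`. -/
noncomputable def ofCompat {k : ℕ} (α : O.Form k) (hα : IsCompat α) : O.OrbForm k :=
  have h : ∀ p : O.N, (Quot.mk _ (Function.surjInv toX_surjective (O.toX p),
      α.1 (Function.surjInv toX_surjective (O.toX p))) : O.Bundle k) = Quot.mk _ (p, α.1 p) :=
    fun p ↦ mk_eq_of_compat hα (Function.surjInv_eq toX_surjective (O.toX p))
  { toFun := fun x ↦ Quot.mk _ (Function.surjInv toX_surjective x,
      α.1 (Function.surjInv toX_surjective x))
    continuous_toFun := by
      refine ((isOpenMap_toX (O := O)).isQuotientMap continuous_toX toX_surjective).continuous_iff.2 ?_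
      have : Continuous fun p : O.N ↦ (Quot.mk _ (p, α.1 p) : O.Bundle k) :=
        continuous_quot_mk.comp (continuous_id.prodMk (continuous_form α))
      exact this.congr fun p ↦ (h p).symm
    proj_toFun := fun x ↦ Function.surjInv_eq toX_surjective x
    exists_lift := fun i ↦ ⟨_, α.2 i, fun x ↦ h ⟨i, x⟩⟩ }

theorem isLift_ofCompat {k : ℕ} (α : O.Form k) (hα : IsCompat α) : IsLift (ofCompat α hα) α :=
  fun i x ↦ mk_eq_of_compat hα (Function.surjInv_eq toX_surjective (O.toX ⟨i, x⟩))

theorem lift_ofCompat {k : ℕ} (α : O.Form k) (hα : IsCompat α) : lift (ofCompat α hα) = α :=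
  (isLift_lift _).unique (isLift_ofCompat α hα)

theorem lift_injective {k : ℕ} : Function.Injective (lift : O.OrbForm k → O.Form k) := by
  intro s t h
  ext x
  obtain ⟨p, rfl⟩ := toX_surjective (O := O) x
  rw [(isLift_lift s).apply, (isLift_lift t).apply, h]

theorem isCompat_lift {k : ℕ} (s : O.OrbForm k) : IsCompat (lift s) := (isLift_lift s).isCompat

/-! ### The complex of forms on `X`

Sums, multiples and the exterior derivative of forms on `X` are computed on the local lifts. -/

noncomputable instance (k : ℕ) : Zero (O.OrbForm k) := ⟨ofCompat 0 (.zero k)⟩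
noncomputable instance (k : ℕ) : Add (O.OrbForm k) :=
  ⟨fun s t ↦ ofCompat (lift s + lift t) ((isCompat_lift s).add (isCompat_lift t))⟩
noncomputable instance (k : ℕ) : Neg (O.OrbForm k) :=
  ⟨fun s ↦ ofCompat (-lift s) (isCompat_lift s).neg⟩
noncomputable instance (k : ℕ) : Sub (O.OrbForm k) :=
  ⟨fun s t ↦ ofCompat (lift s - lift t) ((isCompat_lift s).sub (isCompat_lift t))⟩
noncomputable instance (k : ℕ) : SMul ℕ (O.OrbForm k) :=
  ⟨fun c s ↦ ofCompat (c • lift s) ((isCompat_lift s).nsmul c)⟩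
noncomputable instance (k : ℕ) : SMul ℤ (O.OrbForm k) :=
  ⟨fun c s ↦ ofCompat (c • lift s) ((isCompat_lift s).zsmul c)⟩
noncomputable instance (k : ℕ) : SMul ℝ (O.OrbForm k) :=
  ⟨fun c s ↦ ofCompat (c • lift s) ((isCompat_lift s).smul c)⟩

theorem lift_zero (k : ℕ) : lift (0 : O.OrbForm k) = 0 := lift_ofCompat _ _
theorem lift_add {k : ℕ} (s t : O.OrbForm k) : lift (s + t) = lift s + lift t := lift_ofCompat _ _
theorem lift_smul {k : ℕ} (c : ℝ) (s : O.OrbForm k) : lift (c • s) = c • lift s :=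
  lift_ofCompat _ _

noncomputable instance (k : ℕ) : AddCommGroup (O.OrbForm k) :=
  lift_injective.addCommGroup lift (lift_zero k) lift_add (fun _ ↦ lift_ofCompat _ _)
    (fun _ _ ↦ lift_ofCompat _ _) (fun _ _ ↦ lift_ofCompat _ _) (fun _ _ ↦ lift_ofCompat _ _)

noncomputable instance (k : ℕ) : Module ℝ (O.OrbForm k) :=
  lift_injective.module ℝ ⟨⟨lift, lift_zero k⟩, lift_add⟩ lift_smul

variable (O)

/-- The exterior derivative of forms on `X`: the section whose lift is the exterior derivative of the
lift of `s`. -/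
noncomputable def dX (k : ℕ) : O.OrbForm k →ₗ[ℝ] O.OrbForm (k + 1) where
  toFun s := ofCompat (O.dN k (lift s)) (isCompat_lift s).dN
  map_add' s t := lift_injective <| by
    rw [lift_ofCompat, lift_add, lift_add, map_add, lift_ofCompat, lift_ofCompat]
  map_smul' c s := lift_injective <| by
    rw [lift_ofCompat, lift_smul, map_smul, RingHom.id_apply, lift_smul, lift_ofCompat]

end OrbifoldAtlas
end OrbifoldForms

/-! The image of the lifting map and `InvariantForm` are both identified with the forms satisfying
`IsCompat`, i.e. pulled back to themselves by every injection and every group element.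

Lifts: near a regular point of `V i` the map `π` is injective, so a germ of a diffeomorphism over
`X` fixing that point is the identity, and a class in the bundle determines its covector there.
Regular points are dense, since the fixed sets of the finitely many group elements have nowhere
dense frontiers. By continuity lifts are unique (`IsLift.unique`) and compatible
(`IsLift.isCompat`). Conversely, two points of `N` over one point of `X` are joined by group
elements and injections from a common smaller chart, so a compatible form descends to a section
(`ofCompat`). Pull-back commutes with `d`, so compatibility survives `d` (`IsCompat.dN`).

Invariance: an invariant form is compatible because the generators belong to `Γ`. For the converse
no description of the elements of `Γ` is needed: the local homeomorphisms that pull a given form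
back to itself, with invertible derivative, are a pseudogroup (`stabilizer`). For a compatible form
it contains the generators, hence `Γ`. Invertibility of the derivative is part of the condition so
that it is stable under inverses as well as composition. -/

namespace OrbifoldForms
namespace OrbifoldAtlas

universe u v w

variable {n : ℕ} {X : Type u} [TopologicalSpace X] {ι : Type v}
  {O : OrbifoldAtlas.{u, v, w} n X ι} {k : ℕ}

/-! ### Maps of `N` in coordinates -/

/-- The coordinate expression on `V i` of a map `f : N → N`. -/
noncomputable def coord (f : O.N → O.N) (i : ι) : Euc n → Euc n :=
  ext0 fun x : (O.chart i).V ↦ ((f ⟨i, x⟩).2 : Euc n)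

/-- The index equality is a hypothesis because a point near `p` lies in the chart of `p` only
propositionally; substituting it avoids casts between the charts. -/
theorem coord_of_fst_eq (f : O.N → O.N) {q : O.N} {i : ι} (h : q.1 = i) :
    coord f i (q.2 : Euc n) = (f q).2 := by
  subst h
  exact ext0_coe _ _

/-- Inclusions of the `V i` into `N` and into `ℝⁿ` are both open, so germs on `N` can be read as
germs on `ℝⁿ`. -/
theorem eventually_coord {p : O.N} {P : O.N → Prop} (h : ∀ᶠ q in 𝓝 p, P q) :
    ∀ᶠ w in 𝓝 (p.2 : Euc n), ∃ q : O.N, q.1 = p.1 ∧ (q.2 : Euc n) = w ∧ P q := by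
  obtain ⟨i, x⟩ := p
  have h1 : ∀ᶠ y in 𝓝 x, P ⟨i, y⟩ :=
    (continuous_sigmaMk (σ := fun i ↦ (O.chart i).V)).continuousAt.eventually h
  have h2 : Filter.map Subtype.val (𝓝 x) = 𝓝 (x : Euc n) :=
    map_nhds_subtype_coe_eq_nhds x.2 (mem_nhds_coe x)
  change ∀ᶠ w in 𝓝 (x : Euc n), _
  rw [← h2, Filter.eventually_map]
  exact h1.mono fun y hy ↦ ⟨⟨i, y⟩, rfl, rfl, hy⟩

theorem eventually_fst_eq (p : O.N) : ∀ᶠ q in 𝓝 p, q.1 = p.1 := by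
  have h : Set.range (Sigma.mk (β := fun i ↦ (O.chart i).V) p.1) ∈ 𝓝 p :=
    isOpen_range_sigmaMk.mem_nhds ⟨p.2, rfl⟩
  filter_upwards [h]
  rintro _ ⟨y, rfl⟩
  rfl

theorem coord_congr {f g : O.N → O.N} {p : O.N} (h : f =ᶠ[𝓝 p] g) :
    coord f p.1 =ᶠ[𝓝 (p.2 : Euc n)] coord g p.1 := by
  filter_upwards [eventually_coord h]
  rintro _ ⟨q, hq, rfl, e⟩
  rw [coord_of_fst_eq f hq, coord_of_fst_eq g hq, e]

theorem coord_id (p : O.N) : coord (id : O.N → O.N) p.1 =ᶠ[𝓝 (p.2 : Euc n)] id := by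
  filter_upwards [eventually_coord (p := p) (P := fun _ ↦ True) (.of_forall fun _ ↦ trivial)]
  rintro _ ⟨q, hq, rfl, -⟩
  exact coord_of_fst_eq id hq

/-- Continuity of `f` at `p` keeps nearby values in the chart of `f p`, so a single coordinate
expression of `g` suffices. -/
theorem coord_comp (g : O.N → O.N) {f : O.N → O.N} {p : O.N} (hf : ContinuousAt f p) :
    coord (g ∘ f) p.1 =ᶠ[𝓝 (p.2 : Euc n)] coord g (f p).1 ∘ coord f p.1 := by
  filter_upwards [eventually_coord (hf.eventually (eventually_fst_eq (f p)))]
  rintro _ ⟨q, hq, rfl, e⟩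
  rw [Function.comp_apply, coord_of_fst_eq f hq, coord_of_fst_eq g e]
  exact coord_of_fst_eq (g ∘ f) hq

/-- The map `f : N → N` has an invertible derivative at `p`, and it pulls `α` back to itself at
that point. -/
def PullsBackAt (α : O.N → Cov n k) (f : O.N → O.N) (p : O.N) : Prop :=
  ∃ f' : Euc n ≃L[ℝ] Euc n, HasFDerivAt (coord f p.1) (f' : Euc n →L[ℝ] Euc n) (p.2 : Euc n) ∧
    α p = (α (f p)).compContinuousLinearMap (f' : Euc n →L[ℝ] Euc n)

namespace PullsBackAt

variable {α : O.N → Cov n k} {f g : O.N → O.N} {p : O.N}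

/-- Uniqueness of the derivative turns the existential witness into the `fderiv` used by
`InvariantForm`. -/
theorem eq_tangentMap (h : PullsBackAt α f p) :
    α p = (α (f p)).compContinuousLinearMap (O.tangentMap f p) := by
  obtain ⟨f', hf, hα⟩ := h
  have e : O.tangentMap f p = f' := hf.fderiv
  rw [e, hα]

theorem congr (h : PullsBackAt α f p) (e : g =ᶠ[𝓝 p] f) : PullsBackAt α g p := by
  obtain ⟨f', hf, hα⟩ := h
  exact ⟨f', hf.congr_of_eventuallyEq (coord_congr e), by rw [e.eq_of_nhds, hα]⟩

protected theorem id (α : O.N → Cov n k) (p : O.N) : PullsBackAt α id p :=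
  ⟨.refl ℝ _, (hasFDerivAt_id _).congr_of_eventuallyEq (coord_id p), by ext; rfl⟩

theorem comp (hg : PullsBackAt α g (f p)) (hf : PullsBackAt α f p) (hc : ContinuousAt f p) :
    PullsBackAt α (g ∘ f) p := by
  obtain ⟨f', hf, hα⟩ := hf
  obtain ⟨g', hg, hβ⟩ := hg
  rw [← coord_of_fst_eq f rfl] at hg
  refine ⟨f'.trans g', (hg.comp _ hf).congr_of_eventuallyEq (coord_comp g hc), ?_⟩
  rw [hα, hβ]
  rfl

/-- The easy half of the inverse function theorem: a merely continuous local right inverse of a map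
with invertible derivative is differentiable, with the inverse derivative. Thus inverses in
`stabilizer` need no smoothness assumption. -/
theorem of_local_left_inverse (hf : PullsBackAt α f (g p)) (hg : ContinuousAt g p)
    (hfg : ∀ᶠ q in 𝓝 p, f (g q) = q) : PullsBackAt α g p := by
  obtain ⟨f', hf, hα⟩ := hf
  have hgp : coord g p.1 p.2 = (g p).2 := coord_of_fst_eq g rfl
  have hr : f ∘ g =ᶠ[𝓝 p] id := hfg
  have hc : ContinuousAt (coord g p.1) (p.2 : Euc n) := by
    have h : ContinuousAt (fun x ↦ ((g ⟨p.1, x⟩).2 : Euc n)) p.2 := by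
      have h1 : Continuous fun q : O.N ↦ (q.2 : Euc n) :=
        continuous_sigma fun i ↦ continuous_subtype_val
      exact h1.continuousAt.comp (ContinuousAt.comp (g := g) (f := Sigma.mk p.1) hg
        continuous_sigmaMk.continuousAt)
    -- `V` is open in `ℝⁿ`, so continuity of the extension by zero can be tested along `V`.
    rw [ContinuousAt, ← map_nhds_subtype_coe_eq_nhds p.2.2 (mem_nhds_coe p.2),
      Filter.tendsto_map'_iff, hgp]
    refine Filter.Tendsto.congr (fun x ↦ ?_) h
    exact (ext0_coe (fun x : (O.chart p.1).V ↦ ((g ⟨p.1, x⟩).2 : Euc n)) x).symm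
  refine ⟨f'.symm, .of_local_left_inverse hc (hgp ▸ hf) ?_, ?_⟩
  · exact (coord_comp f hg).symm.trans ((coord_congr hr).trans (coord_id p))
  · rw [hα, show f (g p) = p from hfg.self_of_nhds]
    ext m
    simp only [ContinuousAlternatingMap.compContinuousLinearMap_apply]
    congr 1
    funext t
    simp

end PullsBackAt

/-- The pseudogroup of all local diffeomorphisms of `N` that pull `α` back to itself. -/
def stabilizer (α : O.N → Cov n k) : StructureGroupoid O.N where
  members := {γ | ∀ p ∈ γ.source, PullsBackAt α γ p}
  trans' e e' he he' p hp := by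
    rw [OpenPartialHomeomorph.trans_source] at hp
    exact (he' _ hp.2).comp (he p hp.1) (e.continuousAt hp.1)
  symm' e he p hp :=
    (he _ (e.map_target hp)).of_local_left_inverse (e.symm.continuousAt hp)
      (e.eventually_right_inverse hp)
  id_mem' p _ := .id α p
  locality' e he p hp := by
    obtain ⟨s, hs, hps, h⟩ := he p hp
    -- The source of `e.restr s` involves the interior of `s`, which is `s` itself here.
    exact h p ⟨hp, hs.interior_eq.symm ▸ hps⟩
  mem_of_eqOnSource' e e' he h p hp :=
    (he p (h.1 ▸ hp)).congr (h.eqOn.eventuallyEq_of_mem (e'.open_source.mem_nhds hp))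

instance (α : O.N → Cov n k) : ClosedUnderRestriction (stabilizer α) where
  closedUnderRestriction he _ _ p hp := he p hp.1

/-! ### The generators of `Γ` -/

theorem Elementary.isOpenEmbedding {i j : ι} {f : (O.chart i).V → (O.chart j).V}
    (hf : O.Elementary f) : Topology.IsOpenEmbedding f := by
  rcases hf with φ | g
  · exact φ.isOpenEmbedding
  · exact (show (O.chart i).V ≃ₜ (O.chart i).V from
      { MulAction.toPerm g with
        continuous_toFun := (Elementary.act g).continuous
        continuous_invFun := (Elementary.act g⁻¹).continuous }).isOpenEmbedding

theorem Elementary.exists_generator {i j : ι} {f : (O.chart i).V → (O.chart j).V}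
    (hf : O.Elementary f) (x : (O.chart i).V) : ∃ γ ∈ O.generators,
      γ.source = Set.range (Sigma.mk i) ∧ ∀ y, γ ⟨i, y⟩ = ⟨j, f y⟩ := by
  have : Nonempty (O.chart i).V := ⟨x⟩
  have h1 : Topology.IsOpenEmbedding (Sigma.mk (β := fun i ↦ (O.chart i).V) i) := .sigmaMk
  have h2 : Topology.IsOpenEmbedding fun y ↦ (⟨j, f y⟩ : O.N) :=
    Topology.IsOpenEmbedding.comp (.sigmaMk (σ := fun i ↦ (O.chart i).V) (i := j)) hf.isOpenEmbedding
  -- Leave `N` for `V i` by the inverse of the inclusion, then re-enter through `y ↦ ⟨j, f y⟩`.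
  let γ := (h1.toOpenPartialHomeomorph _).symm.trans (h2.toOpenPartialHomeomorph _)
  have hs : γ.source = Set.range (Sigma.mk i) := by
    simp [γ]
  have hγ : ∀ y, γ ⟨i, y⟩ = ⟨j, f y⟩ := fun y ↦ by
    simp [γ, h1.toOpenPartialHomeomorph_left_inv]
  exact ⟨γ, ⟨i, j, f, hf, hs, hγ⟩, hs, hγ⟩

theorem generators_subset_Γ {γ : OpenPartialHomeomorph O.N O.N} (hγ : γ ∈ O.generators) :
    γ ∈ O.Γ :=
  Set.mem_iInter₂.2 fun _ hP ↦ hP.2 γ hγ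

/-- Minimality of `Γ`, serving as its induction principle. -/
theorem Γ_subset {P : StructureGroupoid O.N} [ClosedUnderRestriction P]
    (hP : ∀ γ ∈ O.generators, γ ∈ P) {γ : OpenPartialHomeomorph O.N O.N} (hγ : γ ∈ O.Γ) : γ ∈ P :=
  Set.mem_iInter₂.1 hγ P ⟨inferInstance, hP⟩

theorem coord_mk {f : O.N → O.N} {i j : ι} {φ : (O.chart i).V → (O.chart j).V}
    (h : ∀ y, f ⟨i, y⟩ = ⟨j, φ y⟩) : coord f i = ext0 fun y ↦ (φ y : Euc n) := by
  refine congrArg ext0 (funext fun y ↦ ?_)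
  rw [h]

theorem IsCompat.mem_stabilizer {α : O.Form k} (hα : IsCompat α)
    {γ : OpenPartialHomeomorph O.N O.N} (hγ : γ ∈ O.generators) : γ ∈ stabilizer α.1 := by
  obtain ⟨i, j, f, hf, hs, h⟩ := hγ
  intro p hp
  rw [hs] at hp
  obtain ⟨x, rfl⟩ := hp
  -- An injective endomorphism of the finite-dimensional space `ℝⁿ` is invertible.
  let e := (LinearEquiv.ofInjectiveEndo
    (D (fun y ↦ (f y : Euc n)) x : Euc n →ₗ[ℝ] Euc n) (hf.injective_D x)).toContinuousLinearEquiv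
  have he : (e : Euc n →L[ℝ] Euc n) = D (fun y ↦ (f y : Euc n)) x := by
    ext1 v
    rfl
  refine ⟨e, ?_, ?_⟩
  · rw [he, coord_mk h]
    exact ((hf.smooth.contDiffAt x).differentiableAt (by simp)).hasFDerivAt
  · rw [he, h]
    exact hα f hf x

/-- The invariant forms on `N` are those compatible with the gluing of the cotangent bundles. -/
theorem mem_invariantForm_iff {α : O.Form k} : α ∈ O.InvariantForm k ↔ IsCompat α := by
  refine ⟨fun hα i j f hf x ↦ ?_, fun hα γ hγ p hp ↦ ?_⟩
  · obtain ⟨γ, hγ, hs, h⟩ := hf.exists_generator x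
    have h1 := hα γ (generators_subset_Γ hγ) ⟨i, x⟩ (hs ▸ ⟨x, rfl⟩)
    have h2 : O.tangentMap γ ⟨i, x⟩ = D (fun y ↦ (f y : Euc n)) x :=
      congrArg (fun F ↦ fderiv ℝ F (x : Euc n)) (coord_mk h)
    rwa [h2, h] at h1
  · have h : γ ∈ stabilizer α.1 := Γ_subset (fun _ ↦ hα.mem_stabilizer) hγ
    exact (h p hp).eq_tangentMap

/-! ### The chain isomorphism -/

theorem dN_dN (α : O.Form k) : O.dN (k + 1) (O.dN k α) = 0 := by
  ext1
  funext p
  -- The extension by zero of `dα` equals `extDeriv` of the extension of `α` near `p`, which is all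
  -- that the outer derivative sees.
  have e : res (O.dN k α).1 p.1 =ᶠ[𝓝 (p.2 : Euc n)] extDeriv (res α.1 p.1) := by
    filter_upwards [mem_nhds_coe p.2] with x hx
    rw [res_mem _ _ hx]
    rfl
  change extDeriv (res (O.dN k α).1 p.1) (p.2 : Euc n) = 0
  rw [e.extDeriv_eq]
  refine extDeriv_extDeriv_apply (contDiffAt_res α p.1 p.2) ?_
  -- Over `ℝ` the identity `d² = 0` asks for class `C²` only.
  rw [minSmoothness_of_isRCLikeNormedField]
  exact WithTop.coe_le_coe.2 (le_top (a := (2 : ℕ∞)))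

theorem lift_dX (s : O.OrbForm k) : lift (O.dX k s) = O.dN k (lift s) :=
  lift_ofCompat _ (isCompat_lift s).dN

variable (O k) in
/-- The linear map sending a form on `X` to the form on `N` given by its local lifts. -/
noncomputable def liftₗ : O.OrbForm k →ₗ[ℝ] O.Form k where
  toFun := lift
  map_add' := lift_add
  map_smul' := lift_smul

theorem range_liftₗ : LinearMap.range (liftₗ O k) = O.InvariantForm k := by
  ext α
  rw [mem_invariantForm_iff]
  constructor
  · rintro ⟨s, rfl⟩
    exact isCompat_lift s
  · exact fun hα ↦ ⟨ofCompat α hα, lift_ofCompat α hα⟩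

end OrbifoldAtlas
end OrbifoldForms

theorem mainTheorem9 {n : ℕ} {X : Type*} [TopologicalSpace X] [T2Space X]
    [SecondCountableTopology X] {ι : Type*} (O : OrbifoldForms.OrbifoldAtlas n X ι)
    (hO : O.ClosedUnderIntersections) :
    -- `Ω*(X)` and `Ω*(N)` are cochain complexes, and `Ω*_Γ(N)` is a subcomplex of `Ω*(N)`
    (∀ k, O.dX (k + 1) ∘ₗ O.dX k = 0) ∧ (∀ k, O.dN (k + 1) ∘ₗ O.dN k = 0) ∧
    (∀ k, ∀ α ∈ O.InvariantForm k, O.dN k α ∈ O.InvariantForm (k + 1)) ∧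
    -- the lifts of forms on `X` define a chain isomorphism of `Ω*(X)` onto `Ω*_Γ(N)`
    ∃ Φ : ∀ k, O.OrbForm k →ₗ[ℝ] O.Form k,
      (∀ k s α, OrbifoldForms.OrbifoldAtlas.IsLift s α ↔ α = Φ k s) ∧
      (∀ k s, Φ (k + 1) (O.dX k s) = O.dN k (Φ k s)) ∧
      (∀ k, Function.Injective (Φ k)) ∧
      (∀ k, LinearMap.range (Φ k) = O.InvariantForm k) := by
  refine ⟨fun k ↦ ?_, fun k ↦ ?_, fun k α hα ↦ ?_, fun k ↦ OrbifoldForms.OrbifoldAtlas.liftₗ O k,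
    fun k s α ↦ ⟨fun h ↦ h.unique (OrbifoldForms.OrbifoldAtlas.isLift_lift s), ?_⟩,
    fun k s ↦ OrbifoldForms.OrbifoldAtlas.lift_dX s,
    fun k ↦ OrbifoldForms.OrbifoldAtlas.lift_injective,
    fun k ↦ OrbifoldForms.OrbifoldAtlas.range_liftₗ⟩
  -- On `X`, `d² = 0` is inherited from `N` through the injective lifting map.
  · refine LinearMap.ext fun s ↦ OrbifoldForms.OrbifoldAtlas.lift_injective ?_
    rw [LinearMap.comp_apply, OrbifoldForms.OrbifoldAtlas.lift_dX,
      OrbifoldForms.OrbifoldAtlas.lift_dX, OrbifoldForms.OrbifoldAtlas.dN_dN, LinearMap.zero_apply,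
      OrbifoldForms.OrbifoldAtlas.lift_zero]
  · exact LinearMap.ext OrbifoldForms.OrbifoldAtlas.dN_dN
  · rw [OrbifoldForms.OrbifoldAtlas.mem_invariantForm_iff] at hα ⊢
    exact hα.dN
  · rintro rfl
    exact OrbifoldForms.OrbifoldAtlas.isLift_lift s
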